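/- **Notation.** All tensor products are over $\mathbb{C}$. A Lie conformal algebra is a $\mathbb{C}[\partial]$-module $L$ with a $\mathbb{C}$-linear $\lambda$-bracket $L\otimes L\to\mathbb{C}[\lambda]\otimes L$, $a\otimes b\mapsto[a_\lambda b]$, such that $[\partial a_\lambda b]=-\lambda[a_\lambda b]$, $[a_\lambda\partial b]=(\lambda+\partial)[a_\lambda b]$, $[a_\lambda b]=-[b_{-\lambda-\partial}\,a]$ and $[a_\lambda[b_\mu c]]=[[a_\lambda b]_{\lambda+\mu}c]+[b_\mu[a_\lambda c]]$. An ideal is a $\mathbb{C}[\partial]$-submodule $I$ with $[a_\lambda b]\in\mathbb{C}[\lambda]\otimes I$ for $a\in L$, $b\in I$; it has cofinite rank if $L/I$ has finite rank as a $\mathbb{C}[\partial]$-module. The conformal dual $L^{*c}$ is the space of $\mathbb{C}$-linear maps $f:L\to\mathbb{C}[\lambda]$ with $f_\lambda(\partial b)=\lambda f_\lambda(b)$, a $\mathbb{C}[\partial]$-module by $(\partial f)_\lambda=-\lambda f_\lambda$. For $f,g\in L^{*c}$ and $a,b\in L$ put $[\pi_\mu(f)]_\lambda(a\otimes b)=f_\lambda([a_\mu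 b])$ and $[\Phi_\mu(f\otimes g)]_\lambda(a\otimes b)=f_\mu(a)\,g_{\lambda-\mu}(b)$, both in $\mathbb{C}[\lambda,\mu]$. A $\mathbb{C}[\partial]$-submodule $V\subseteq L^{*c}$ is good if $\pi_\mu(V)\subseteq\Phi_{-\mu}(V\otimes V)$, and $L^0$ is the sum of all good submodules of $L^{*c}$. It is itself good, and the map $\delta:L^0\to L^0\otimes L^0$ determined by $\Phi_{-\mu}\circ\delta=\pi_\mu$ makes it a differential Lie coalgebra, i.e. a $\mathbb{C}[\partial]$-module with a $\mathbb{C}[\partial]$-linear map $\delta$ (where $\partial$ acts on the tensor square as $\partial\otimes1+1\otimes\partial$) such that $\tau\delta=-\delta$ and $(1\otimes\delta)\delta-(\tau\otimes1)(1\otimes\delta)\delta=(\delta\otimes1)\delta$, where $\tau(a\otimes b)=b\otimes a$. A subcoalgebra of a differential Lie coalgebra $M$ is a $\mathbb{C}[\partial]$-submodule $N$ with $\delta(N)\subseteq N\otimes N$; it is locally finite if each of its elements lies in a subcoalgebra of finite rank contained in $N$. $\operatorname{Loc}(M)$ is the sum of all finite-rank subcoalgebras of $M$. **Theorem.** Let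 $L$ be a Lie conformal algebra that is free as a $\mathbb{C}[\partial]$-module. Then $$\operatorname{Loc}(L^0)=\{f\in L^{*c}\mid \ker f\text{ contains an ideal of }L\text{ of cofinite rank}\}.$$ Moreover, $\operatorname{Loc}(L^0)$ is the sum of all good submodules of $L^{*c}$ of finite rank, and it is the largest locally finite subcoalgebra of $L^0$. -/

import Mathlib

open scoped TensorProduct Polynomial

noncomputable section

namespace LieConf

/-! ## Differential modules

`ℂ[X]` plays the role of `ℂ[∂]`: a `ℂ[∂]`-module is a `Module ℂ[X] M`, with `∂` acting as `X`.
The `ℂ`-vector space structure of `M` is the one underlying the `ℂ[∂]`-module structure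
(`IsScalarTower ℂ ℂ[X] M`). -/

section Modules

variable (M : Type*) [AddCommGroup M] [Module ℂ M] [Module ℂ[X] M] [IsScalarTower ℂ ℂ[X] M]

/-- The derivation `∂`, as a `ℂ`-linear endomorphism of a `ℂ[∂]`-module. -/
def der : M →ₗ[ℂ] M where
  toFun m := (Polynomial.X : ℂ[X]) • m
  map_add' := smul_add _
  map_smul' c m := (smul_comm c (Polynomial.X : ℂ[X]) m).symm

/-- A `ℂ[∂]`-module has finite rank: every linearly independent family has less than
`n` members, for some `n`. -/
def HasFiniteRank (M : Type*) [AddCommGroup M] [Module ℂ[X] M] : Prop :=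
  Module.rank ℂ[X] M < Cardinal.aleph0

end Modules

/-! ## Lie conformal algebras -/

/-- The ring `ℂ[λ, μ]`. -/
abbrev Poly2 : Type := MvPolynomial (Fin 2) ℂ

/-- The variable `λ` of `ℂ[λ, μ]`. -/
abbrev lam : Poly2 := MvPolynomial.X 0

/-- The variable `μ` of `ℂ[λ, μ]`. -/
abbrev mu : Poly2 := MvPolynomial.X 1

section Bracket

variable {L : Type*} [AddCommGroup L] [Module ℂ L] [Module ℂ[X] L] [IsScalarTower ℂ ℂ[X] L]

/-- Substitution `λ ↦ x` in `ℂ[λ] ⊗ L`, for an element `x` of a commutative `ℂ`-algebra `A`;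
the result is in `A ⊗ L`. -/
def substAt {A : Type*} [CommRing A] [Algebra ℂ A] (x : A) : ℂ[X] ⊗[ℂ] L →ₗ[ℂ] A ⊗[ℂ] L :=
  (Polynomial.aeval x).toLinearMap.rTensor L

/-- Substitution `λ ↦ -λ - ∂` in `ℂ[λ] ⊗ L`, with `∂` moved to the left and acting on `L`:
`∑ λⁿ ⊗ cₙ` is sent to `∑ (-λ - ∂)ⁿ (1 ⊗ cₙ)`. -/
def substNeg : ℂ[X] ⊗[ℂ] L →ₗ[ℂ] ℂ[X] ⊗[ℂ] L :=
  TensorProduct.lift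
    (LinearMap.mk₂ ℂ
      (fun p v => (Polynomial.aeval
        (-(der ℂ[X]).rTensor L - (der L).lTensor ℂ[X] : Module.End ℂ (ℂ[X] ⊗[ℂ] L)) p)
          ((1 : ℂ[X]) ⊗ₜ[ℂ] v))
      (fun p q v => by simp)
      (fun c p v => by simp)
      (fun p v w => by simp [TensorProduct.tmul_add])
      (fun c p v => by simp))

end Bracket

/-- A Lie conformal algebra: a `ℂ[∂]`-module `L` with a `ℂ`-bilinear `λ`-bracket
`L ⊗ L → ℂ[λ] ⊗ L` satisfying conformal sesquilinearity, skew-symmetry and the Jacobi identity.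
The Jacobi identity is an identity in `ℂ[λ, μ] ⊗ L`, where brackets are extended
`ℂ[λ, μ]`-linearly in the relevant argument. -/
class LieConformalAlgebra (L : Type*) [AddCommGroup L] [Module ℂ L] [Module ℂ[X] L]
    [IsScalarTower ℂ ℂ[X] L] where
  /-- the bracket `[a_λ b]` -/
  bracket : L →ₗ[ℂ] L →ₗ[ℂ] ℂ[X] ⊗[ℂ] L
  /-- `[∂a_λ b] = -λ [a_λ b]` -/
  bracket_der_left : ∀ a b : L,
    bracket (der L a) b = -(Polynomial.X : ℂ[X]) • bracket a b
  /-- `[a_λ ∂b] = (λ + ∂) [a_λ b]` -/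
  bracket_der_right : ∀ a b : L,
    bracket a (der L b)
      = (Polynomial.X : ℂ[X]) • bracket a b + (der L).lTensor ℂ[X] (bracket a b)
  /-- `[a_λ b] = -[b_{-λ-∂} a]` -/
  skew : ∀ a b : L, bracket a b = -substNeg (bracket b a)
  /-- `[a_λ [b_μ c]] = [[a_λ b]_{λ+μ} c] + [b_μ [a_λ c]]` -/
  jacobi : ∀ a b c : L,
    (substAt lam ∘ₗ bracket a).liftBaseChange Poly2 (substAt mu (bracket b c))
      = (substAt (lam + mu) ∘ₗ bracket.flip c).liftBaseChange Poly2 (substAt lam (bracket a b))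
        + (substAt mu ∘ₗ bracket b).liftBaseChange Poly2 (substAt lam (bracket a c))

section Ideal

variable {L : Type*} [AddCommGroup L] [Module ℂ L] [Module ℂ[X] L] [IsScalarTower ℂ ℂ[X] L]
  [LieConformalAlgebra L]

/-- An ideal of a Lie conformal algebra: a `ℂ[∂]`-submodule `I` with
`[a_λ b] ∈ ℂ[λ] ⊗ I` for all `a ∈ L` and `b ∈ I` (by skew-symmetry then also `[b_λ a] ∈ ℂ[λ] ⊗ I`). -/
def IsIdeal (I : Submodule ℂ[X] L) : Prop :=
  ∀ a : L, ∀ b ∈ I, LieConformalAlgebra.bracket a b ∈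
    LinearMap.range ((I.subtype.restrictScalars ℂ).lTensor ℂ[X])

end Ideal

/-! ## Differential Lie coalgebras -/

/-- A differential Lie coalgebra: a `ℂ[∂]`-module `C` with a homomorphism of `ℂ[∂]`-modules
`δ : C → C ⊗ C` (tensor product over `ℂ`, with `∂` acting as `∂ ⊗ 1 + 1 ⊗ ∂`) that satisfies
co-skew-symmetry and the co-Jacobi identity. -/
class DifferentialLieCoalgebra (C : Type*) [AddCommGroup C] [Module ℂ C] [Module ℂ[X] C]
    [IsScalarTower ℂ ℂ[X] C] where
  /-- the cobracket -/
  δ : C →ₗ[ℂ] C ⊗[ℂ] C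
  δ_der : ∀ x : C, δ (der C x) = (der C).rTensor C (δ x) + (der C).lTensor C (δ x)
  /-- `τ ∘ δ = -δ` -/
  coskew : ∀ x : C, TensorProduct.comm ℂ C C (δ x) = -δ x
  /-- `(1 ⊗ δ) δ - (τ ⊗ 1) (1 ⊗ δ) δ = (δ ⊗ 1) δ` -/
  cojacobi : ∀ x : C,
    δ.lTensor C (δ x)
        - TensorProduct.assoc ℂ C C C
            ((TensorProduct.comm ℂ C C).toLinearMap.rTensor C
              ((TensorProduct.assoc ℂ C C C).symm (δ.lTensor C (δ x))))
      = TensorProduct.assoc ℂ C C C (δ.rTensor C (δ x))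

/-- The subspace `N ⊗ N` of `M ⊗ M` (tensor product over `ℂ`), for a `ℂ[∂]`-submodule `N` of `M`. -/
def tensorSquare {M : Type*} [AddCommGroup M] [Module ℂ M] [Module ℂ[X] M]
    [IsScalarTower ℂ ℂ[X] M] (N : Submodule ℂ[X] M) : Submodule ℂ (M ⊗[ℂ] M) :=
  LinearMap.range
    (TensorProduct.map (N.subtype.restrictScalars ℂ) (N.subtype.restrictScalars ℂ))

section Loc

variable {C : Type*} [AddCommGroup C] [Module ℂ C] [Module ℂ[X] C] [IsScalarTower ℂ ℂ[X] C]
  [DifferentialLieCoalgebra C]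

/-- A `ℂ[∂]`-submodule `N` with `δ(N) ⊆ N ⊗ N`. -/
def IsSubcoalgebra (N : Submodule ℂ[X] C) : Prop :=
  ∀ x ∈ N, DifferentialLieCoalgebra.δ x ∈ tensorSquare N

/-- A subcoalgebra `N` is locally finite: every element of `N` is in a subcoalgebra of finite rank
that is contained in `N`. -/
def IsLocallyFinite (N : Submodule ℂ[X] C) : Prop :=
  ∀ x ∈ N, ∃ D : Submodule ℂ[X] C, D ≤ N ∧ IsSubcoalgebra D ∧ HasFiniteRank D ∧ x ∈ D

variable (C) in
/-- The locally finite part: the sum of all subcoalgebras of finite rank. -/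
def Loc : Submodule ℂ[X] C :=
  sSup {N : Submodule ℂ[X] C | IsSubcoalgebra N ∧ HasFiniteRank N}

end Loc

/-! ## The conformal dual -/

section Dual

variable (L : Type*) [AddCommGroup L] [Module ℂ L] [Module ℂ[X] L] [IsScalarTower ℂ ℂ[X] L]

/-- The `ℂ`-linear maps `f : L → ℂ[λ]` with `f_λ(∂b) = λ f_λ(b)`, as a subspace. -/
def dualSubmodule : Submodule ℂ (L →ₗ[ℂ] ℂ[X]) where
  carrier := {f | ∀ b : L, f (der L b) = Polynomial.X * f b}
  add_mem' hf hg b := by simp [hf b, hg b, mul_add]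
  zero_mem' b := by simp
  smul_mem' c f hf b := by simp [hf b]

/-- The conformal dual of a `ℂ[∂]`-module. -/
def ConformalDual : Type _ := dualSubmodule L

namespace ConformalDual

instance : AddCommGroup (ConformalDual L) := inferInstanceAs (AddCommGroup (dualSubmodule L))

instance : Module ℂ (ConformalDual L) := inferInstanceAs (Module ℂ (dualSubmodule L))

variable {L}

/-- The `ℂ`-linear map `f_λ : L → ℂ[λ]`. -/
def toLin : ConformalDual L →ₗ[ℂ] L →ₗ[ℂ] ℂ[X] := (dualSubmodule L).subtype

instance : CoeFun (ConformalDual L) (fun _ => L → ℂ[X]) := ⟨fun f => toLin f⟩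

@[ext] theorem ext {f g : ConformalDual L} (h : ∀ a, f a = g a) : f = g :=
  Subtype.ext (LinearMap.ext h)

theorem apply_der (f : ConformalDual L) (b : L) : f (der L b) = Polynomial.X * f b := f.2 b

@[simp] theorem add_apply (f g : ConformalDual L) (a : L) : (f + g) a = f a + g a := rfl

@[simp] theorem zero_apply (a : L) : (0 : ConformalDual L) a = 0 := rfl

@[simp] theorem smul_apply (c : ℂ) (f : ConformalDual L) (a : L) : (c • f) a = c • f a := rfl

/-- The action of `ℂ[∂]` on the conformal dual: `(p(∂) f)_λ = p(-λ) f_λ`;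
in particular `(∂f)_λ = -λ f_λ`. -/
instance : SMul ℂ[X] (ConformalDual L) where
  smul p f := ⟨LinearMap.mulLeft ℂ (p.comp (-Polynomial.X)) ∘ₗ toLin f, fun b => by
    simp only [LinearMap.comp_apply, LinearMap.mulLeft_apply]
    rw [apply_der]; ring⟩

theorem poly_smul_apply (p : ℂ[X]) (f : ConformalDual L) (a : L) :
    (p • f) a = p.comp (-Polynomial.X) * f a := rfl

instance : Module ℂ[X] (ConformalDual L) where
  one_smul f := by ext1 a; simp [poly_smul_apply]
  mul_smul p q f := by ext1 a; simp [poly_smul_apply, mul_assoc]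
  smul_zero p := by ext1 a; simp [poly_smul_apply]
  smul_add p f g := by ext1 a; simp [poly_smul_apply, mul_add]
  add_smul p q f := by ext1 a; simp [poly_smul_apply, add_mul]
  zero_smul f := by ext1 a; simp [poly_smul_apply]

instance : IsScalarTower ℂ ℂ[X] (ConformalDual L) where
  smul_assoc c p f := by ext1 a; simp [poly_smul_apply]

/-- `(∂f)_λ = -λ f_λ` -/
theorem der_apply (f : ConformalDual L) (a : L) :
    (der (ConformalDual L) f) a = -Polynomial.X * f a := by
  change ((Polynomial.X : ℂ[X]) • f) a = _
  simp [poly_smul_apply]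

/-- The map `f_x : L → A` obtained from `f` by the substitution `λ ↦ x`, for an element `x` of a
commutative `ℂ`-algebra `A`. -/
def subst {A : Type*} [CommRing A] [Algebra ℂ A] (x : A) : ConformalDual L →ₗ[ℂ] L →ₗ[ℂ] A :=
  LinearMap.llcomp ℂ L ℂ[X] A (Polynomial.aeval x).toLinearMap ∘ₗ toLin

end ConformalDual

/-- The map `Φ_x` with second variable `y`:
`[Φ_x(f ⊗ g)]_y (a ⊗ b) = f_x(a) g_{y - x}(b)`, for elements `x, y` of a commutative `ℂ`-algebra. -/
def Phi {A : Type*} [CommRing A] [Algebra ℂ A] (x y : A) :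
    ConformalDual L ⊗[ℂ] ConformalDual L →ₗ[ℂ] L →ₗ[ℂ] L →ₗ[ℂ] A :=
  TensorProduct.lift
    (LinearMap.mk₂ ℂ
      (fun f g => (LinearMap.mul ℂ A).compl₁₂ (ConformalDual.subst x f) (ConformalDual.subst (y - x) g))
      (fun f f' g => by ext a b; simp)
      (fun c f g => by ext a b; simp)
      (fun f g g' => by ext a b; simp [mul_add])
      (fun c f g => by ext a b; simp))

variable {L} in
theorem Phi_tmul {A : Type*} [CommRing A] [Algebra ℂ A] (x y : A) (f g : ConformalDual L)
    (a b : L) : Phi L x y (f ⊗ₜ g) a b = ConformalDual.subst x f a * ConformalDual.subst (y - x) g b :=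
  rfl

variable [LieConformalAlgebra L]

/-- The map `π_μ`: `[π_μ(f)]_λ (a ⊗ b) = f_λ([a_μ b]) ∈ ℂ[λ, μ]`, where `f_λ` is extended
`ℂ[μ]`-linearly to `ℂ[μ] ⊗ L`. -/
def piMap : ConformalDual L →ₗ[ℂ] L →ₗ[ℂ] L →ₗ[ℂ] Poly2 where
  toFun f := (LieConformalAlgebra.bracket (L := L)).compr₂
    ((((ConformalDual.subst lam f).liftBaseChange Poly2).restrictScalars ℂ) ∘ₗ substAt mu)
  map_add' f g := by
    ext1 a; ext1 b
    simp [LinearMap.compr₂_apply, LinearMap.liftBaseChange]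
  map_smul' c f := by
    ext1 a; ext1 b
    have key : ∀ t : Poly2 ⊗[ℂ] L, (ConformalDual.subst lam (c • f)).liftBaseChange Poly2 t
        = c • (ConformalDual.subst lam f).liftBaseChange Poly2 t := by
      intro t
      induction t with
      | zero => simp
      | add s t hs ht => simp only [map_add, hs, ht, smul_add]
      | tmul p v => simp
    exact key _

variable {L}

/-- A `ℂ[∂]`-submodule `V` of the conformal dual is good if `π_μ(V) ⊆ Φ_{-μ}(V ⊗ V)`. -/
def IsGood (V : Submodule ℂ[X] (ConformalDual L)) : Prop :=
  ∀ f ∈ V, piMap L f ∈ (tensorSquare V).map (Phi L (-mu) lam)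

variable (L) in
/-- The upper zero `L⁰`: the sum of all good submodules of the conformal dual. -/
def upperZero : Submodule ℂ[X] (ConformalDual L) :=
  sSup {V : Submodule ℂ[X] (ConformalDual L) | IsGood V}

end Dual

/-! ## The differential Lie coalgebra structure of a good submodule -/

section Separation

variable {E F : Type*} [AddCommGroup E] [Module ℂ E] [AddCommGroup F] [Module ℂ F]

/-- The functional `φ ⊗ ψ` on `E ⊗ F`. -/
def tensorFun (φ : E →ₗ[ℂ] ℂ) (ψ : F →ₗ[ℂ] ℂ) : E ⊗[ℂ] F →ₗ[ℂ] ℂ :=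
  LinearMap.mul' ℂ ℂ ∘ₗ TensorProduct.map φ ψ

@[simp] theorem tensorFun_tmul (φ : E →ₗ[ℂ] ℂ) (ψ : F →ₗ[ℂ] ℂ) (x : E) (y : F) :
    tensorFun φ ψ (x ⊗ₜ y) = φ x * ψ y := rfl

theorem tensorFun_separates {ι κ : Type*} (φ : ι → E →ₗ[ℂ] ℂ) (ψ : κ → F →ₗ[ℂ] ℂ)
    (hφ : ∀ x, (∀ i, φ i x = 0) → x = 0) (hψ : ∀ y, (∀ j, ψ j y = 0) → y = 0)
    (t : E ⊗[ℂ] F) (ht : ∀ i j, tensorFun (φ i) (ψ j) t = 0) : t = 0 := by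
  have h1 : ∀ i, TensorProduct.lid ℂ F ((φ i).rTensor F t) = 0 := by
    intro i
    apply hψ
    intro j
    rw [← ht i j]
    clear ht
    induction t with
    | zero => simp
    | add x y hx hy => simp only [map_add, hx, hy]
    | tmul x y => simp
  classical
  let B := Module.Basis.ofVectorSpace ℂ F
  apply (TensorProduct.equivFinsuppOfBasisRight (M := E) B).injective
  rw [map_zero]
  ext k
  apply hφ
  intro i
  have h2 : φ i (TensorProduct.equivFinsuppOfBasisRight (M := E) B t k)
      = B.repr (TensorProduct.lid ℂ F ((φ i).rTensor F t)) k := by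
    clear h1 ht
    induction t with
    | zero => simp
    | add x y hx hy => simp only [map_add, Finsupp.add_apply, hx, hy]
    | tmul x y => simp [mul_comm]
  rw [h2, h1 i]; simp

end Separation

section Good

variable {L : Type*} [AddCommGroup L] [Module ℂ L] [Module ℂ[X] L] [IsScalarTower ℂ ℂ[X] L]

/-- The functional `f ↦ f_x(a) ∈ ℂ` on a submodule of the conformal dual, for `a ∈ L`, `x ∈ ℂ`. -/
def evalFun (V : Submodule ℂ[X] (ConformalDual L)) (p : L × ℂ) : V →ₗ[ℂ] ℂ :=
  (ConformalDual.subst p.2).flip p.1 ∘ₗ V.subtype.restrictScalars ℂ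

theorem evalFun_apply (V : Submodule ℂ[X] (ConformalDual L)) (p : L × ℂ) (f : V) :
    evalFun V p f = (f.1 p.1).eval p.2 := by
  change Polynomial.aeval p.2 (f.1 p.1) = _
  rw [Polynomial.coe_aeval_eq_eval]

theorem evalFun_separates (V : Submodule ℂ[X] (ConformalDual L)) (f : V)
    (h : ∀ p, evalFun V p f = 0) : f = 0 := by
  apply Subtype.ext
  ext1 a
  apply Polynomial.funext
  intro x
  have := h (a, x)
  rw [evalFun_apply] at this
  simpa using this

theorem evalFun_der (V : Submodule ℂ[X] (ConformalDual L)) (p : L × ℂ) (f : V) :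
    evalFun V p (der V f) = -p.2 * evalFun V p f := by
  rw [evalFun_apply, evalFun_apply]
  change Polynomial.eval p.2 (der (ConformalDual L) f.1 p.1) = _
  rw [ConformalDual.der_apply]
  simp

/-- `Φ_{-μ}` on `V ⊗ V`. -/
def phiOn (V : Submodule ℂ[X] (ConformalDual L)) :
    V ⊗[ℂ] V →ₗ[ℂ] L →ₗ[ℂ] L →ₗ[ℂ] Poly2 :=
  Phi L (-mu) lam ∘ₗ
    TensorProduct.map (V.subtype.restrictScalars ℂ) (V.subtype.restrictScalars ℂ)

/-- Evaluation of `[Φ_{-μ}(t)]_λ (a ⊗ b)` at `λ = x + y`, `μ = -x`. -/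
theorem eval_phiOn (V : Submodule ℂ[X] (ConformalDual L)) (t : V ⊗[ℂ] V) (a b : L) (x y : ℂ) :
    MvPolynomial.aeval ![x + y, -x] (phiOn V t a b)
      = tensorFun (evalFun V (a, x)) (evalFun V (b, y)) t := by
  induction t with
  | zero => simp
  | add s t hs ht => simp only [map_add, LinearMap.add_apply, hs, ht]
  | tmul f g =>
    rw [tensorFun_tmul]
    change MvPolynomial.aeval ![x + y, -x]
      (Polynomial.aeval (-mu) (f.1 a) * Polynomial.aeval (lam - -mu) (g.1 b))
        = Polynomial.aeval x (f.1 a) * Polynomial.aeval y (g.1 b)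
    rw [map_mul, ← Polynomial.aeval_algHom_apply, ← Polynomial.aeval_algHom_apply]
    simp

theorem phiOn_injective (V : Submodule ℂ[X] (ConformalDual L)) :
    Function.Injective (phiOn V) := by
  rw [injective_iff_map_eq_zero]
  intro t ht
  refine tensorFun_separates (evalFun V) (evalFun V) (evalFun_separates V) (evalFun_separates V)
    t ?_
  rintro ⟨a, x⟩ ⟨b, y⟩
  rw [← eval_phiOn, ht]
  simp

variable [LieConformalAlgebra L]

theorem pi_mem_range {V : Submodule ℂ[X] (ConformalDual L)} (hV : IsGood V) (f : V) :
    (piMap L ∘ₗ V.subtype.restrictScalars ℂ) f ∈ LinearMap.range (phiOn V) := by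
  obtain ⟨_, ⟨t, rfl⟩, ht⟩ := hV f.1 f.2
  exact ⟨t, ht⟩

/-- The cobracket `δ_V : V → V ⊗ V` of a good submodule, determined by
`Φ_{-μ} ∘ δ_V = π_μ`. -/
def goodDelta {V : Submodule ℂ[X] (ConformalDual L)} (hV : IsGood V) : V →ₗ[ℂ] V ⊗[ℂ] V :=
  (LinearEquiv.ofInjective (phiOn V) (phiOn_injective V)).symm.toLinearMap ∘ₗ
    (piMap L ∘ₗ V.subtype.restrictScalars ℂ).codRestrict _ (pi_mem_range hV)

theorem phiOn_goodDelta {V : Submodule ℂ[X] (ConformalDual L)} (hV : IsGood V) (f : V) :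
    phiOn V (goodDelta hV f) = piMap L f.1 := by
  have := (LinearEquiv.ofInjective (phiOn V) (phiOn_injective V)).apply_symm_apply
    ((piMap L ∘ₗ V.subtype.restrictScalars ℂ).codRestrict _ (pi_mem_range hV) f)
  exact congrArg Subtype.val this

/-- The value `[a_x b] ∈ L` of the bracket at a complex number `x`. -/
def evBracket (x : ℂ) (a b : L) : L :=
  TensorProduct.lid ℂ L (substAt x (LieConformalAlgebra.bracket a b))

/-- `f_{x+y}([a_{-x} b]) = ∑ (f₁)_x(a) (f₂)_y(b)` -/
theorem tensorFun_goodDelta {V : Submodule ℂ[X] (ConformalDual L)} (hV : IsGood V) (f : V)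
    (a b : L) (x y : ℂ) :
    tensorFun (evalFun V (a, x)) (evalFun V (b, y)) (goodDelta hV f)
      = evalFun V (evBracket (-x) a b, x + y) f := by
  rw [← eval_phiOn, phiOn_goodDelta]
  change MvPolynomial.aeval ![x + y, -x] ((ConformalDual.subst lam f.1).liftBaseChange Poly2
    (substAt mu (LieConformalAlgebra.bracket a b))) = Polynomial.aeval (x + y) (f.1 (evBracket _ a b))
  unfold evBracket
  generalize LieConformalAlgebra.bracket a b = t
  induction t with
  | zero => simp
  | add s t hs ht => simp only [map_add, hs, ht]
  | tmul p v =>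
    change MvPolynomial.aeval ![x + y, -x] (Polynomial.aeval mu p * Polynomial.aeval lam (f.1 v)) =
      Polynomial.aeval (x + y) (ConformalDual.toLin f.1 (Polynomial.aeval (-x) p • v))
    rw [map_mul, ← Polynomial.aeval_algHom_apply, ← Polynomial.aeval_algHom_apply]
    simp

theorem evalFun_evBracket_skew (V : Submodule ℂ[X] (ConformalDual L)) (f : V) (a b : L)
    (x w : ℂ) :
    evalFun V (evBracket x a b, w) f = -evalFun V (evBracket (-x - w) b a, w) f := by
  have key : ∀ t : ℂ[X] ⊗[ℂ] L,
      evalFun V (TensorProduct.lid ℂ L (substAt x (substNeg t)), w) f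
        = evalFun V (TensorProduct.lid ℂ L (substAt (-x - w) t), w) f := by
    let h : L →ₗ[ℂ] ℂ := ConformalDual.subst w f.1
    let H : ℂ[X] ⊗[ℂ] L →ₗ[ℂ] ℂ := h ∘ₗ (TensorProduct.lid ℂ L).toLinearMap ∘ₗ substAt x
    have hder : ∀ v, h (der L v) = w * h v := by
      intro v
      change Polynomial.aeval w (f.1 (der L v)) = w * Polynomial.aeval w (f.1 v)
      rw [ConformalDual.apply_der]; simp
    let D : Module.End ℂ (ℂ[X] ⊗[ℂ] L) := -(der ℂ[X]).rTensor L - (der L).lTensor ℂ[X]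
    have hH : ∀ (p : ℂ[X]) (v : L), H (p ⊗ₜ v) = p.eval x * h v := by
      intro p v
      change h (Polynomial.aeval x p • v) = _
      simp
    have hD : ∀ s, H (D s) = (-x - w) * H s := by
      intro s
      induction s with
      | zero => simp
      | add s t hs ht => simp only [map_add, hs, ht, mul_add]
      | tmul p v =>
        have : D (p ⊗ₜ v) = -((Polynomial.X * p) ⊗ₜ v) - p ⊗ₜ der L v := rfl
        rw [this, map_sub, map_neg, hH, hH, hH, hder]
        simp; ring
    have hp : ∀ (p : ℂ[X]) s, H (Polynomial.aeval D p s) = p.eval (-x - w) * H s := by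
      intro p
      induction p using Polynomial.induction_on' with
      | add p q hp hq => intro s; simp [hp, hq, add_mul]
      | monomial n c =>
        intro s
        have : ∀ s, H ((D ^ n) s) = (-x - w) ^ n * H s := by
          induction n with
          | zero => intro s; simp
          | succ n ih => intro s; rw [pow_succ, Module.End.mul_apply, ih, hD]; ring
        simp [Polynomial.aeval_monomial, this, mul_assoc]
    intro t
    change H (substNeg t) = h (TensorProduct.lid ℂ L (substAt (-x - w) t))
    induction t with
    | zero => simp
    | add s t hs ht => simp only [map_add, hs, ht]
    | tmul p v =>
      change H (Polynomial.aeval D p (1 ⊗ₜ v)) = h (Polynomial.aeval (-x - w) p • v)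
      rw [hp, hH]
      simp
  have := key (LieConformalAlgebra.bracket b a)
  unfold evBracket
  rw [← this, LieConformalAlgebra.skew a b, map_neg, map_neg]
  simp [evalFun]

theorem evBracket_jacobi (x y : ℂ) (a b c : L) :
    evBracket x a (evBracket y b c)
      = evBracket (x + y) (evBracket x a b) c + evBracket y b (evBracket x a c) := by
  let e : Poly2 →ₐ[ℂ] ℂ := MvPolynomial.aeval ![x, y]
  let E : Poly2 ⊗[ℂ] L →ₗ[ℂ] L :=
    (TensorProduct.lid ℂ L).toLinearMap ∘ₗ e.toLinearMap.rTensor L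
  have hEsmul : ∀ (p : Poly2) s, E (p • s) = e p • E s := by
    intro p s
    induction s with
    | zero => simp
    | add s t hs ht => simp only [map_add, smul_add, hs, ht]
    | tmul q v =>
      change e (p * q) • v = e p • (e q • v)
      rw [map_mul, mul_smul]
  have hEsubst : ∀ (q : Poly2) (t : ℂ[X] ⊗[ℂ] L),
      E (substAt q t) = TensorProduct.lid ℂ L (substAt (e q) t) := by
    intro q t
    induction t with
    | zero => simp
    | add s t hs ht => simp only [map_add, hs, ht]
    | tmul p v =>
      change e (Polynomial.aeval q p) • v = Polynomial.aeval (e q) p • v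
      rw [Polynomial.aeval_algHom_apply]
  have hlift : ∀ (q : Poly2) (l : L →ₗ[ℂ] ℂ[X] ⊗[ℂ] L) (s : Poly2 ⊗[ℂ] L),
      E ((substAt q ∘ₗ l).liftBaseChange Poly2 s)
        = TensorProduct.lid ℂ L (substAt (e q) (l (E s))) := by
    intro q l s
    induction s with
    | zero => simp
    | add s t hs ht => simp only [map_add, hs, ht]
    | tmul p v =>
      rw [LinearMap.liftBaseChange_tmul, hEsmul]
      change e p • E (substAt q (l v)) = _
      rw [hEsubst]
      change _ = TensorProduct.lid ℂ L (substAt (e q) (l (e p • v)))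
      simp only [map_smul]
  have h := congrArg E (LieConformalAlgebra.jacobi a b c)
  rw [map_add, hlift, hlift, hlift, hEsubst, hEsubst, hEsubst] at h
  have e0 : e lam = x := by simp [e]
  have e1 : e mu = y := by simp [e]
  rw [map_add, e0, e1] at h
  exact h

/-- A good submodule of the conformal dual is a differential Lie coalgebra. -/
@[reducible] def goodCoalgebra {V : Submodule ℂ[X] (ConformalDual L)} (hV : IsGood V) :
    DifferentialLieCoalgebra V where
  δ := goodDelta hV
  δ_der f := by
    rw [← sub_eq_zero]
    refine tensorFun_separates (evalFun V) (evalFun V) (evalFun_separates V)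
      (evalFun_separates V) _ ?_
    rintro ⟨a, x⟩ ⟨b, y⟩
    have h : ∀ t : V ⊗[ℂ] V, tensorFun (evalFun V (a, x)) (evalFun V (b, y))
        ((der V).rTensor V t + (der V).lTensor V t)
          = -(x + y) * tensorFun (evalFun V (a, x)) (evalFun V (b, y)) t := by
      intro t
      induction t with
      | zero => simp
      | add s t hs ht =>
        simp only [map_add] at hs ht ⊢
        linear_combination hs + ht
      | tmul f g =>
        simp only [LinearMap.rTensor_tmul, LinearMap.lTensor_tmul, map_add, tensorFun_tmul,
          evalFun_der]
        ring
    rw [map_sub, h, tensorFun_goodDelta, tensorFun_goodDelta, evalFun_der]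
    ring
  coskew f := by
    rw [← sub_eq_zero]
    refine tensorFun_separates (evalFun V) (evalFun V) (evalFun_separates V)
      (evalFun_separates V) _ ?_
    rintro ⟨a, x⟩ ⟨b, y⟩
    have h : ∀ t : V ⊗[ℂ] V, tensorFun (evalFun V (a, x)) (evalFun V (b, y))
        (TensorProduct.comm ℂ V V t) = tensorFun (evalFun V (b, y)) (evalFun V (a, x)) t := by
      intro t
      induction t with
      | zero => simp
      | add s t hs ht => simp only [map_add, hs, ht]
      | tmul f g => simp [mul_comm]
    have hneg : tensorFun (evalFun V (a, x)) (evalFun V (b, y)) (-goodDelta hV f)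
        = -tensorFun (evalFun V (a, x)) (evalFun V (b, y)) (goodDelta hV f) :=
      (tensorFun (evalFun V (a, x)) (evalFun V (b, y))).map_neg (goodDelta hV f)
    rw [map_sub, hneg, h, tensorFun_goodDelta, tensorFun_goodDelta,
      evalFun_evBracket_skew V f a b, add_comm y x]
    rw [show - -x - (x + y) = -y by ring]
    ring
  cojacobi f := by
    rw [← sub_eq_zero]
    refine tensorFun_separates (evalFun V)
      (fun j : (L × ℂ) × (L × ℂ) => tensorFun (evalFun V j.1) (evalFun V j.2))
      (evalFun_separates V)
      (fun t ht => tensorFun_separates (evalFun V) (evalFun V) (evalFun_separates V)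
        (evalFun_separates V) t (fun i j => ht (i, j))) _ ?_
    rintro ⟨a, x⟩ ⟨⟨b, y⟩, ⟨c, z⟩⟩
    have h1 : ∀ (p q r : L × ℂ) (t : V ⊗[ℂ] V),
        tensorFun (evalFun V p) (tensorFun (evalFun V q) (evalFun V r))
          ((goodDelta hV).lTensor V t)
        = tensorFun (evalFun V p) (evalFun V (evBracket (-q.2) q.1 r.1, q.2 + r.2)) t := by
      intro p q r t
      induction t with
      | zero => simp
      | add s t hs ht => simp only [map_add, hs, ht]
      | tmul f g =>
        rw [LinearMap.lTensor_tmul, tensorFun_tmul, tensorFun_tmul,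
          tensorFun_goodDelta hV g q.1 r.1 q.2 r.2]
    have h2 : ∀ (p q r : L × ℂ) (t : V ⊗[ℂ] V),
        tensorFun (evalFun V p) (tensorFun (evalFun V q) (evalFun V r))
          (TensorProduct.assoc ℂ V V V ((goodDelta hV).rTensor V t))
        = tensorFun (evalFun V (evBracket (-p.2) p.1 q.1, p.2 + q.2)) (evalFun V r) t := by
      intro p q r t
      have h3 : ∀ (s : V ⊗[ℂ] V) (g : V),
          tensorFun (evalFun V p) (tensorFun (evalFun V q) (evalFun V r))
            (TensorProduct.assoc ℂ V V V (s ⊗ₜ g))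
          = tensorFun (evalFun V p) (evalFun V q) s * evalFun V r g := by
        intro s g
        induction s with
        | zero => simp
        | add s t hs ht => simp only [TensorProduct.add_tmul, map_add, hs, ht, add_mul]
        | tmul f f' => simp [mul_assoc]
      induction t with
      | zero => simp
      | add s t hs ht => simp only [map_add, hs, ht]
      | tmul f g => rw [LinearMap.rTensor_tmul, h3, tensorFun_goodDelta hV f p.1 q.1 p.2 q.2,
          tensorFun_tmul]
    have h4 : ∀ (p q r : L × ℂ) (t : V ⊗[ℂ] (V ⊗[ℂ] V)),
        tensorFun (evalFun V p) (tensorFun (evalFun V q) (evalFun V r))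
          (TensorProduct.assoc ℂ V V V ((TensorProduct.comm ℂ V V).toLinearMap.rTensor V
            ((TensorProduct.assoc ℂ V V V).symm t)))
        = tensorFun (evalFun V q) (tensorFun (evalFun V p) (evalFun V r)) t := by
      intro p q r t
      induction t with
      | zero => simp
      | add s t hs ht => simp only [map_add, hs, ht]
      | tmul f s =>
        induction s with
        | zero => simp
        | add s t hs ht => simp only [TensorProduct.tmul_add, map_add, hs, ht]
        | tmul g g' => simp; ring
    rw [map_sub, map_sub, h4, h1, h1, h2, tensorFun_goodDelta, tensorFun_goodDelta,
      tensorFun_goodDelta]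
    dsimp only
    have hJ := evBracket_jacobi (-x) (-y) a b c
    rw [hJ]
    rw [show -(x + y) = -x + -y by ring, show y + (x + z) = x + (y + z) by ring,
      show x + y + z = x + (y + z) by ring]
    have hadd : ∀ (u v : L) (w : ℂ),
        evalFun V (u + v, w) f = evalFun V (u, w) f + evalFun V (v, w) f := by
      intro u v w
      simp [evalFun]
    rw [hadd]
    ring

theorem tensorSquare_mono {M : Type*} [AddCommGroup M] [Module ℂ M] [Module ℂ[X] M]
    [IsScalarTower ℂ ℂ[X] M] {N N' : Submodule ℂ[X] M} (h : N ≤ N') :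
    tensorSquare N ≤ tensorSquare N' := by
  rintro _ ⟨t, rfl⟩
  induction t with
  | zero => simp
  | add s t hs ht => rw [map_add]; exact add_mem hs ht
  | tmul x y => exact ⟨(⟨x.1, h x.2⟩ : N') ⊗ₜ (⟨y.1, h y.2⟩ : N'), rfl⟩

variable (L) in
/-- The upper zero is a good submodule. -/
theorem isGood_upperZero : IsGood (upperZero L) := by
  intro f hf
  unfold upperZero at hf
  rw [sSup_eq_iSup'] at hf
  induction hf using Submodule.iSup_induction' with
  | mem V f hf =>
    exact Submodule.map_mono (tensorSquare_mono (le_sSup V.2)) (V.2 f hf)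
  | zero => rw [map_zero]; exact zero_mem _
  | add f g _ _ hf hg => rw [map_add]; exact add_mem hf hg

/-- `L⁰` with the cobracket determined by `Φ_{-μ} ∘ δ = π_μ`. -/
instance : DifferentialLieCoalgebra (upperZero L) := goodCoalgebra (isGood_upperZero L)

end Good

end LieConf

end

/-! Since `Φ_{-μ}` is injective, a submodule of `L⁰` is a subcoalgebra exactly when it is good in
the conformal dual (`isSubcoalgebra_iff_isGood_map`). Good submodules of finite rank are closed
under binary sums, so they form a directed family. An element of `Loc` therefore lies in a single
one of them, which gives the second and third claims.

For the description by ideals, submodules `V` of the dual are played against submodules `I` of `L`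
through `commonKer V` and `dualAnn I`. Both operations turn finite rank into finite corank or
conversely, because the values lie in the domain `ℂ[λ]`.

If `V` is good, each `π_μ(f)` with `f ∈ V` vanishes on `L × commonKer V`. Hence every `f ∈ V` kills
the coefficients of `[a_μ b]` for `b ∈ commonKer V`, and `commonKer V` is an ideal
(`IsGood.isIdeal_commonKer`).

Conversely, let `I` be an ideal of cofinite rank and `K = commonKer (dualAnn I) ⊇ I`. Then `L ⧸ K`
is free of finite rank, and for `f ∈ dualAnn I` the form `π_μ(f)` vanishes when either argument is
in `K`. In a basis of `L ⧸ K` with coordinate functionals `g i ∈ dualAnn I`, sesquilinearity writes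
the form as a sum of terms `P * g i (a) * g j (b)` with `λ` replaced by `-μ` and `λ + μ` in the two
factors. The polynomial `P` is absorbed by letting `∂` act on the factors (`exists_Phi_eq_mul`), so
`dualAnn I` is good (`IsIdeal.isGood_dualAnn`). -/

noncomputable section

namespace LieConf

/-! ## Finite rank -/

section Rank

universe u

variable {M : Type u} [AddCommGroup M] [Module ℂ[X] M]

theorem HasFiniteRank.of_injective {M' : Type u} [AddCommGroup M'] [Module ℂ[X] M']
    (h : HasFiniteRank M) (g : M' →ₗ[ℂ[X]] M) (hg : Function.Injective g) : HasFiniteRank M' :=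
  (LinearMap.rank_le_of_injective g hg).trans_lt h

theorem HasFiniteRank.sup {V W : Submodule ℂ[X] M} (hV : HasFiniteRank V)
    (hW : HasFiniteRank W) : HasFiniteRank (V ⊔ W : Submodule ℂ[X] M) :=
  (Submodule.rank_add_le_rank_add_rank V W).trans_lt (Cardinal.add_lt_aleph0 hV hW)

theorem hasFiniteRank_of_finite (M : Type*) [AddCommGroup M] [Module ℂ[X] M]
    [Module.Finite ℂ[X] M] : HasFiniteRank M :=
  Module.rank_lt_aleph0 ℂ[X] M

theorem hasFiniteRank_map_iff {M' : Type u} [AddCommGroup M'] [Module ℂ[X] M']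
    {g : M →ₗ[ℂ[X]] M'} (hg : Function.Injective g) (N : Submodule ℂ[X] M) :
    HasFiniteRank (N.map g) ↔ HasFiniteRank N := by
  unfold HasFiniteRank
  rw [(Submodule.equivMapOfInjective g hg N).rank_eq]

/-- A module of finite rank contains a finite set modulo whose span it is torsion. -/
theorem HasFiniteRank.exists_finite_torsion (h : HasFiniteRank M) :
    ∃ s : Set M, s.Finite ∧ ∀ x : M, ∃ p : ℂ[X], p ≠ 0 ∧ p • x ∈ Submodule.span ℂ[X] s := by
  obtain ⟨s, hs, hli⟩ := exists_set_linearIndependent_of_isDomain ℂ[X] M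
  have hfin : Cardinal.mk s < Cardinal.aleph0 := hs ▸ h
  refine ⟨s, Cardinal.lt_aleph0_iff_set_finite.mp hfin, fun x => ?_⟩
  -- By rank additivity the quotient by the span of a maximal independent set has rank zero. The
  -- cancellation is legitimate because the rank is finite.
  have h0 : Module.rank ℂ[X] (M ⧸ Submodule.span ℂ[X] s) = 0 := by
    have := Submodule.rank_quotient_add_rank (Submodule.span ℂ[X] s)
    rw [rank_span_set hli, hs] at this
    exact Cardinal.eq_of_add_eq_add_right (this.trans (zero_add _).symm) h
  obtain ⟨p, hp, hpx⟩ := rank_eq_zero_iff.mp h0 (Submodule.Quotient.mk x)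
  refine ⟨p, hp, ?_⟩
  rwa [← Submodule.Quotient.mk_smul, Submodule.Quotient.mk_eq_zero] at hpx

end Rank

/-! ## Polynomial linearity of the conformal dual -/

section Pairing

variable {L : Type*} [AddCommGroup L] [Module ℂ L] [Module ℂ[X] L] [IsScalarTower ℂ ℂ[X] L]

/-- Serves elements of the dual (`x = λ`) and the two arguments of `π_μ` (`x = -μ` and `x = λ + μ`).
-/
theorem map_poly_smul_of_map_der {A : Type*} [CommRing A] [Algebra ℂ A] (F : L →ₗ[ℂ] A) (x : A)
    (hF : ∀ v, F (der L v) = x * F v) (p : ℂ[X]) (v : L) :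
    F (p • v) = Polynomial.aeval x p * F v := by
  induction p using Polynomial.induction_on' with
  | add p q hp hq => rw [add_smul, map_add, hp, hq, map_add, add_mul]
  | monomial n c =>
    induction n with
    | zero =>
      rw [Polynomial.monomial_zero_left, Polynomial.aeval_C, ← Polynomial.algebraMap_eq,
        algebraMap_smul, map_smul, Algebra.smul_def]
    | succ n ih =>
      rw [← Polynomial.X_mul_monomial, mul_smul, map_mul, Polynomial.aeval_X, mul_assoc, ← ih]
      exact hF _

theorem ConformalDual.apply_poly_smul (f : ConformalDual L) (p : ℂ[X]) (a : L) :
    f (p • a) = p * f a := by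
  rw [map_poly_smul_of_map_der (toLin f) Polynomial.X f.apply_der, Polynomial.aeval_X_left_apply]

/-- An element of the conformal dual, as a homomorphism of `ℂ[∂]`-modules. -/
def ConformalDual.toPolyLin (f : ConformalDual L) : L →ₗ[ℂ[X]] ℂ[X] where
  toFun := f
  map_add' := map_add _
  map_smul' := f.apply_poly_smul

/-- The element of the conformal dual given by a homomorphism of `ℂ[∂]`-modules. -/
def ConformalDual.ofPolyLin (g : L →ₗ[ℂ[X]] ℂ[X]) : ConformalDual L :=
  ⟨g.restrictScalars ℂ, fun b => g.map_smul Polynomial.X b⟩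

theorem ConformalDual.ofPolyLin_apply (g : L →ₗ[ℂ[X]] ℂ[X]) (a : L) :
    ConformalDual.ofPolyLin g a = g a := rfl

/-- The elements of `L` killed by a submodule of the conformal dual. -/
def commonKer (V : Submodule ℂ[X] (ConformalDual L)) : Submodule ℂ[X] L where
  carrier := {a | ∀ f ∈ V, f a = 0}
  add_mem' ha hb f hf := by rw [map_add, ha f hf, hb f hf, add_zero]
  zero_mem' f _ := map_zero _
  smul_mem' p a ha f hf := by rw [ConformalDual.apply_poly_smul, ha f hf, mul_zero]

/-- The elements of the conformal dual that vanish on a submodule of `L`. -/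
def dualAnn (I : Submodule ℂ[X] L) : Submodule ℂ[X] (ConformalDual L) where
  carrier := {f | ∀ a ∈ I, f a = 0}
  add_mem' hf hg a ha := by rw [ConformalDual.add_apply, hf a ha, hg a ha, add_zero]
  zero_mem' a _ := rfl
  smul_mem' p f hf a ha := by rw [ConformalDual.poly_smul_apply, hf a ha, mul_zero]

/-! ### Finite rank under passage to annihilators -/

theorem comp_neg_X_ne_zero {p : ℂ[X]} (hp : p ≠ 0) : p.comp (-Polynomial.X) ≠ 0 := by
  intro h
  apply hp
  have := congrArg (fun q : ℂ[X] => q.comp (-Polynomial.X)) h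
  simpa [Polynomial.comp_assoc] using this

/-- A finite set `s` modulo whose span `V` is torsion already cuts out `commonKer V`: some nonzero
multiple of each `f ∈ V` lies in the span of `s`, and `ℂ[λ]` has no zero divisors. -/
theorem exists_injective_quotient_commonKer {V : Submodule ℂ[X] (ConformalDual L)}
    (hV : HasFiniteRank V) :
    ∃ (s : Set V) (_ : s.Finite) (g : (L ⧸ commonKer V) →ₗ[ℂ[X]] (s → ℂ[X])),
      Function.Injective g := by
  obtain ⟨s, hs, ht⟩ := hV.exists_finite_torsion
  refine ⟨s, hs, (commonKer V).liftQ (LinearMap.pi fun f : s => f.1.1.toPolyLin) ?_, ?_⟩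
  · intro a ha
    ext1 f
    exact ha f.1.1 f.1.2
  · rw [← LinearMap.ker_eq_bot]
    refine Submodule.ker_liftQ_eq_bot _ _ _ fun a ha f hf => ?_
    obtain ⟨p, hp, hpf⟩ := ht ⟨f, hf⟩
    -- Here `dualAnn (span {a})` is just the submodule of functionals vanishing at `a`.
    have hle : Submodule.span ℂ[X] s ≤ (dualAnn (Submodule.span ℂ[X] {a})).comap V.subtype := by
      refine Submodule.span_le.mpr fun g hg b hb => ?_
      obtain ⟨q, rfl⟩ := Submodule.mem_span_singleton.mp hb
      have : g.1 a = 0 := congrFun ha ⟨g, hg⟩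
      change g.1 (q • a) = 0
      rw [ConformalDual.apply_poly_smul, this, mul_zero]
    have h0 : (p • f) a = 0 := hle hpf a (Submodule.mem_span_singleton_self a)
    rw [ConformalDual.poly_smul_apply] at h0
    exact (mul_eq_zero.mp h0).resolve_left (comp_neg_X_ne_zero hp)

theorem finite_quotient_commonKer {V : Submodule ℂ[X] (ConformalDual L)}
    (hV : HasFiniteRank V) : Module.Finite ℂ[X] (L ⧸ commonKer V) := by
  obtain ⟨s, hs, g, hg⟩ := exists_injective_quotient_commonKer hV
  have := hs.to_subtype
  exact Module.Finite.of_injective g hg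

/-- A submodule of a finite free module over the principal ideal domain `ℂ[X]` is free. -/
theorem free_quotient_commonKer {V : Submodule ℂ[X] (ConformalDual L)}
    (hV : HasFiniteRank V) : Module.Free ℂ[X] (L ⧸ commonKer V) := by
  obtain ⟨s, hs, g, hg⟩ := exists_injective_quotient_commonKer hV
  have := hs.to_subtype
  exact Module.Free.of_equiv (LinearEquiv.ofInjective g hg).symm

/-- Evaluation at an element of `L`, twisted by `∂ ↦ -∂` to be `ℂ[∂]`-linear. -/
def ConformalDual.evalPolyLin (a : L) : ConformalDual L →ₗ[ℂ[X]] ℂ[X] where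
  toFun f := (f a).comp (-Polynomial.X)
  map_add' f g := by simp
  map_smul' p f := by
    simp [ConformalDual.poly_smul_apply, Polynomial.mul_comp, Polynomial.comp_assoc]

/-- A functional vanishing on `I` descends to `L ⧸ I`. As `ℂ[X]` is torsion-free, it is determined
by its values on a finite set modulo whose span `L ⧸ I` is torsion. -/
theorem hasFiniteRank_dualAnn {I : Submodule ℂ[X] L} (hI : HasFiniteRank (L ⧸ I)) :
    HasFiniteRank (dualAnn I) := by
  obtain ⟨s, hs, ht⟩ := hI.exists_finite_torsion
  have := hs.to_subtype
  let g : dualAnn I →ₗ[ℂ[X]] (s → ℂ[X]) :=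
    LinearMap.pi (fun x : s => ConformalDual.evalPolyLin x.1.out) ∘ₗ (dualAnn I).subtype
  have hg : Function.Injective g := by
    rw [injective_iff_map_eq_zero]
    intro f hf
    apply Subtype.ext
    ext1 a
    let F : (L ⧸ I) →ₗ[ℂ[X]] ℂ[X] := I.liftQ f.1.toPolyLin f.2
    obtain ⟨p, hp, hpa⟩ := ht (Submodule.Quotient.mk a)
    have hle : Submodule.span ℂ[X] s ≤ LinearMap.ker F := by
      refine Submodule.span_le.mpr fun x hx => ?_
      have h0 : (f.1 (x.out)).comp (-Polynomial.X) = 0 := congrFun hf ⟨x, hx⟩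
      have h1 : f.1 x.out = 0 := by
        by_contra h
        exact comp_neg_X_ne_zero h h0
      have h2 : F (Submodule.Quotient.mk x.out) = 0 := h1
      rwa [show Submodule.Quotient.mk x.out = x from Quotient.out_eq _] at h2
    have h0 : F (p • Submodule.Quotient.mk a) = 0 := hle hpa
    rw [map_smul, smul_eq_mul] at h0
    exact (mul_eq_zero.mp h0).resolve_left hp
  have := Module.Finite.of_injective g hg
  exact hasFiniteRank_of_finite _

end Pairing

/-! ## Subcoalgebras of the upper zero and good submodules -/

section Subcoalgebra

variable {L : Type*} [AddCommGroup L] [Module ℂ L] [Module ℂ[X] L] [IsScalarTower ℂ ℂ[X] L]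

theorem tensorSquare_map_subtype {M : Type*} [AddCommGroup M] [Module ℂ M] [Module ℂ[X] M]
    [IsScalarTower ℂ ℂ[X] M] (V : Submodule ℂ[X] M) (N : Submodule ℂ[X] V) :
    tensorSquare (N.map V.subtype) = (tensorSquare N).map
      (TensorProduct.map (V.subtype.restrictScalars ℂ) (V.subtype.restrictScalars ℂ)) := by
  apply le_antisymm
  · rintro _ ⟨t, rfl⟩
    induction t with
    | zero => simp
    | add s t hs ht => rw [map_add]; exact add_mem hs ht
    | tmul x y =>
      obtain ⟨_, ⟨x, hx, rfl⟩⟩ := x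
      obtain ⟨_, ⟨y, hy, rfl⟩⟩ := y
      exact ⟨x ⊗ₜ y, ⟨(⟨x, hx⟩ : N) ⊗ₜ (⟨y, hy⟩ : N), rfl⟩, rfl⟩
  · rintro _ ⟨_, ⟨t, rfl⟩, rfl⟩
    induction t with
    | zero => simp
    | add s t hs ht => simp only [map_add]; exact add_mem hs ht
    | tmul x y =>
      exact ⟨(⟨x.1, ⟨x.1, x.2, rfl⟩⟩ : N.map V.subtype) ⊗ₜ
        (⟨y.1, ⟨y.1, y.2, rfl⟩⟩ : N.map V.subtype), rfl⟩

variable [LieConformalAlgebra L]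

/-- `δ x` is the only preimage of `π_μ(x)` under the injective map `phiOn`, so any preimage found in
`N ⊗ N` must be `δ x` itself. -/
theorem isSubcoalgebra_iff_isGood_map (N : Submodule ℂ[X] (upperZero L)) :
    IsSubcoalgebra N ↔ IsGood (N.map (upperZero L).subtype) := by
  have hδ : ∀ x : upperZero L,
      phiOn (upperZero L) (DifferentialLieCoalgebra.δ x) = piMap L x.1 :=
    phiOn_goodDelta (isGood_upperZero L)
  have hmap : (tensorSquare (N.map (upperZero L).subtype)).map (Phi L (-mu) lam)
      = (tensorSquare N).map (phiOn (upperZero L)) := by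
    rw [tensorSquare_map_subtype, ← Submodule.map_comp]
    rfl
  unfold IsGood
  rw [hmap]
  constructor
  · rintro h _ ⟨x, hx, rfl⟩
    exact ⟨_, h x hx, hδ x⟩
  · intro h x hx
    obtain ⟨t, ht, htx⟩ := h x.1 ⟨x, hx, rfl⟩
    rwa [← phiOn_injective _ (htx.trans (hδ x).symm)]

theorem IsGood.sup {V W : Submodule ℂ[X] (ConformalDual L)} (hV : IsGood V) (hW : IsGood W) :
    IsGood (V ⊔ W) := by
  intro f hf
  obtain ⟨g, hg, h, hh, rfl⟩ := Submodule.mem_sup.mp hf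
  rw [map_add]
  exact add_mem (Submodule.map_mono (tensorSquare_mono le_sup_left) (hV g hg))
    (Submodule.map_mono (tensorSquare_mono le_sup_right) (hW h hh))

theorem isGood_bot : IsGood (⊥ : Submodule ℂ[X] (ConformalDual L)) := by
  intro f hf
  rw [(Submodule.mem_bot _).mp hf, map_zero]
  exact zero_mem _

variable (L) in
-- The family is directed, so its sum is its union.
theorem mem_sSup_good_iff {f : ConformalDual L} :
    f ∈ sSup {V : Submodule ℂ[X] (ConformalDual L) | IsGood V ∧ HasFiniteRank V} ↔
      ∃ V : Submodule ℂ[X] (ConformalDual L), IsGood V ∧ HasFiniteRank V ∧ f ∈ V := by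
  rw [Submodule.mem_sSup_of_directed]
  · simp only [Set.mem_ofPred_eq, and_assoc]
  · exact ⟨⊥, isGood_bot, hasFiniteRank_of_finite _⟩
  · rintro V ⟨hV, hV'⟩ W ⟨hW, hW'⟩
    exact ⟨V ⊔ W, ⟨hV.sup hW, hV'.sup hW'⟩, le_sup_left, le_sup_right⟩

theorem hasFiniteRank_map_subtype_iff (N : Submodule ℂ[X] (upperZero L)) :
    HasFiniteRank (N.map (upperZero L).subtype) ↔ HasFiniteRank N :=
  hasFiniteRank_map_iff (upperZero L).injective_subtype N

/-- A good submodule of finite rank, as a subcoalgebra of the upper zero. -/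
theorem IsGood.comap_subtype {V : Submodule ℂ[X] (ConformalDual L)} (hV : IsGood V)
    (hr : HasFiniteRank V) :
    (V.comap (upperZero L).subtype).map (upperZero L).subtype = V ∧
      IsSubcoalgebra (V.comap (upperZero L).subtype) ∧
      HasFiniteRank (V.comap (upperZero L).subtype) := by
  have h : (V.comap (upperZero L).subtype).map (upperZero L).subtype = V := by
    rw [Submodule.map_comap_subtype]
    -- `V` is one of the summands of `L⁰`, so intersecting with `L⁰` loses nothing.
    exact inf_eq_right.mpr (le_sSup hV)
  rw [isSubcoalgebra_iff_isGood_map, ← hasFiniteRank_map_subtype_iff, h]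
  exact ⟨rfl, hV, hr⟩

variable (L) in
theorem map_loc_eq_sSup :
    (Loc (upperZero L)).map (upperZero L).subtype
      = sSup {V : Submodule ℂ[X] (ConformalDual L) | IsGood V ∧ HasFiniteRank V} := by
  apply le_antisymm
  · rw [Submodule.map_le_iff_le_comap]
    refine sSup_le fun N hN => ?_
    rw [← Submodule.map_le_iff_le_comap]
    exact le_sSup ⟨(isSubcoalgebra_iff_isGood_map N).mp hN.1,
      (hasFiniteRank_map_subtype_iff N).mpr hN.2⟩
  · refine sSup_le fun V hV => ?_
    obtain ⟨h, h'⟩ := hV.1.comap_subtype hV.2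
    rw [← h]
    exact Submodule.map_mono (le_sSup h')

theorem exists_subcoalgebra_of_mem_loc {x : upperZero L} (hx : x ∈ Loc (upperZero L)) :
    ∃ D : Submodule ℂ[X] (upperZero L), IsSubcoalgebra D ∧ HasFiniteRank D ∧ x ∈ D := by
  have hx' : x.1 ∈ (Loc (upperZero L)).map (upperZero L).subtype := ⟨x, hx, rfl⟩
  rw [map_loc_eq_sSup, mem_sSup_good_iff] at hx'
  obtain ⟨V, hV, hr, hxV⟩ := hx'
  obtain ⟨-, h1, h2⟩ := hV.comap_subtype hr
  exact ⟨_, h1, h2, hxV⟩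

theorem le_loc {D : Submodule ℂ[X] (upperZero L)} (hD : IsSubcoalgebra D)
    (hr : HasFiniteRank D) : D ≤ Loc (upperZero L) :=
  le_sSup ⟨hD, hr⟩

variable (L) in
-- `Loc` is the union, not only the sum, of the subcoalgebras of finite rank. Local finiteness and
-- maximality are then read off elementwise.
theorem isGreatest_loc :
    IsGreatest {N : Submodule ℂ[X] (upperZero L) | IsSubcoalgebra N ∧ IsLocallyFinite N}
      (Loc (upperZero L)) := by
  refine ⟨⟨fun x hx => ?_, fun x hx => ?_⟩, fun N hN x hx => ?_⟩
  · obtain ⟨D, hD, hr, hxD⟩ := exists_subcoalgebra_of_mem_loc hx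
    exact tensorSquare_mono (le_loc hD hr) (hD x hxD)
  · obtain ⟨D, hD, hr, hxD⟩ := exists_subcoalgebra_of_mem_loc hx
    exact ⟨D, le_loc hD hr, hD, hr, hxD⟩
  · obtain ⟨D, -, hD, hr, hxD⟩ := hN.2 x hx
    exact le_loc hD hr hxD

end Subcoalgebra

/-! ## The map `π_μ` -/

section PiMap

variable {L : Type*} [AddCommGroup L] [Module ℂ L]

theorem substAt_tmul {A : Type*} [CommRing A] [Algebra ℂ A] (x : A) (p : ℂ[X]) (v : L) :
    substAt x (p ⊗ₜ[ℂ] v) = Polynomial.aeval x p ⊗ₜ v := rfl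

theorem substAt_poly_smul {A : Type*} [CommRing A] [Algebra ℂ A] (x : A) (q : ℂ[X])
    (t : ℂ[X] ⊗[ℂ] L) : substAt x (q • t) = Polynomial.aeval x q • substAt x t := by
  induction t with
  | zero => simp
  | add s t hs ht => simp only [map_add, smul_add, hs, ht]
  | tmul p v =>
    rw [TensorProduct.smul_tmul', substAt_tmul, substAt_tmul, TensorProduct.smul_tmul', smul_eq_mul,
      smul_eq_mul, map_mul]

variable [Module ℂ[X] L] [IsScalarTower ℂ ℂ[X] L]

theorem ConformalDual.subst_apply {A : Type*} [CommRing A] [Algebra ℂ A] (x : A)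
    (f : ConformalDual L) (a : L) : ConformalDual.subst x f a = Polynomial.aeval x (f a) := rfl

theorem ConformalDual.subst_der {A : Type*} [CommRing A] [Algebra ℂ A] (x : A)
    (f : ConformalDual L) (a : L) :
    ConformalDual.subst x f (der L a) = x * ConformalDual.subst x f a := by
  rw [subst_apply, subst_apply, apply_der, map_mul, Polynomial.aeval_X]

/-- The bilinear maps in `Φ_{-μ}(V ⊗ V)` are stable under multiplication by `ℂ[λ, μ]`. -/
theorem exists_Phi_eq_mul (V : Submodule ℂ[X] (ConformalDual L)) {g h : ConformalDual L}
    (hg : g ∈ V) (hh : h ∈ V) (P : Poly2) :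
    ∃ t ∈ tensorSquare V, ∀ a b, Phi L (-mu) lam t a b
      = P * (Polynomial.aeval (-mu) (g a) * Polynomial.aeval (lam + mu) (h b)) := by
  induction P using MvPolynomial.induction_on generalizing g h with
  | C c =>
    refine ⟨c • g ⊗ₜ h, (tensorSquare V).smul_mem c ⟨(⟨g, hg⟩ : V) ⊗ₜ (⟨h, hh⟩ : V), rfl⟩, ?_⟩
    intro a b
    rw [map_smul, LinearMap.smul_apply, LinearMap.smul_apply, Phi_tmul, sub_neg_eq_add,
      MvPolynomial.smul_eq_C_mul]
    rfl
  | add P Q hP hQ =>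
    obtain ⟨s, hs, hs'⟩ := hP hg hh
    obtain ⟨t, ht, ht'⟩ := hQ hg hh
    refine ⟨s + t, add_mem hs ht, fun a b => ?_⟩
    rw [map_add, LinearMap.add_apply, LinearMap.add_apply, hs', ht', add_mul]
  | mul_X P i hP =>
    -- At the substituted points `∂g` contributes a factor `μ` and `∂h` a factor `-(λ + μ)`. So `μ`
    -- is realised by `∂` on the first factor, and `λ = (λ + μ) - μ` by minus the sum of both
    -- actions.
    have hdg : der _ g ∈ V := V.smul_mem Polynomial.X hg
    have hdh : der _ h ∈ V := V.smul_mem Polynomial.X hh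
    obtain ⟨s, hs, hs'⟩ := hP hdg hh
    obtain ⟨t, ht, ht'⟩ := hP hg hdh
    fin_cases i
    · refine ⟨-t - s, sub_mem (neg_mem ht) hs, fun a b => ?_⟩
      rw [map_sub, map_neg, LinearMap.sub_apply, LinearMap.sub_apply, LinearMap.neg_apply,
        LinearMap.neg_apply, hs', ht', ConformalDual.der_apply, ConformalDual.der_apply]
      simp only [map_mul, map_neg, Polynomial.aeval_X, Fin.zero_eta]
      ring
    · refine ⟨s, hs, fun a b => ?_⟩
      rw [hs', ConformalDual.der_apply]
      simp only [map_mul, map_neg, Polynomial.aeval_X, Fin.mk_one]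
      ring

variable [LieConformalAlgebra L]

theorem piMap_apply (f : ConformalDual L) (a b : L) :
    piMap L f a b = (ConformalDual.subst lam f).liftBaseChange Poly2
      (substAt mu (LieConformalAlgebra.bracket a b)) := rfl

theorem eval_piMap (f : ConformalDual L) (a b : L) (w x : ℂ) :
    MvPolynomial.aeval ![w, x] (piMap L f a b) = (f (evBracket x a b)).eval w := by
  rw [piMap_apply]
  unfold evBracket
  generalize LieConformalAlgebra.bracket a b = t
  induction t with
  | zero => simp
  | add s t hs ht => simp only [map_add, hs, ht, Polynomial.eval_add]
  | tmul p v =>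
    rw [substAt_tmul, substAt_tmul, LinearMap.liftBaseChange_tmul, TensorProduct.lid_tmul, smul_eq_mul,
      map_mul, ConformalDual.subst_apply, ← Polynomial.aeval_algHom_apply,
      ← Polynomial.aeval_algHom_apply]
    simp

theorem piMap_der_left (f : ConformalDual L) (a b : L) :
    piMap L f (der L a) b = -mu * piMap L f a b := by
  rw [piMap_apply, piMap_apply, LieConformalAlgebra.bracket_der_left, substAt_poly_smul, map_smul,
    smul_eq_mul, map_neg, Polynomial.aeval_X]

theorem piMap_der_right (f : ConformalDual L) (a b : L) :
    piMap L f a (der L b) = (lam + mu) * piMap L f a b := by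
  have h : ∀ t : ℂ[X] ⊗[ℂ] L, (ConformalDual.subst lam f).liftBaseChange Poly2
      (substAt mu ((der L).lTensor ℂ[X] t))
        = lam * (ConformalDual.subst lam f).liftBaseChange Poly2 (substAt mu t) := by
    intro t
    induction t with
    | zero => simp
    | add s t hs ht => simp only [map_add, hs, ht, mul_add]
    | tmul p v =>
      rw [LinearMap.lTensor_tmul, substAt_tmul, substAt_tmul, LinearMap.liftBaseChange_tmul,
        LinearMap.liftBaseChange_tmul, ConformalDual.subst_der, smul_eq_mul, smul_eq_mul]
      ring
  rw [piMap_apply, piMap_apply, LieConformalAlgebra.bracket_der_right, map_add, map_add, h,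
    substAt_poly_smul, Polynomial.aeval_X, map_smul, smul_eq_mul]
  ring

theorem piMap_poly_smul_left (f : ConformalDual L) (p : ℂ[X]) (a b : L) :
    piMap L f (p • a) b = Polynomial.aeval (-mu) p * piMap L f a b :=
  map_poly_smul_of_map_der ((piMap L f).flip b) (-mu) (fun v => piMap_der_left f v b) p a

theorem piMap_poly_smul_right (f : ConformalDual L) (p : ℂ[X]) (a b : L) :
    piMap L f a (p • b) = Polynomial.aeval (lam + mu) p * piMap L f a b :=
  map_poly_smul_of_map_der (piMap L f a) (lam + mu) (piMap_der_right f a) p b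

/-! ### Skew-symmetry of `π_μ` and its coefficients in `μ` -/

theorem poly2_funext {P Q : Poly2}
    (h : ∀ w x : ℂ, MvPolynomial.aeval ![w, x] P = MvPolynomial.aeval ![w, x] Q) : P = Q := by
  refine MvPolynomial.funext fun v => ?_
  have hv : v = ![v 0, v 1] := by ext i; fin_cases i <;> rfl
  have := h (v 0) (v 1)
  rwa [← hv] at this

/-- Skew-symmetry of the bracket identifies `π_μ(f)(a ⊗ b)`, up to sign, with `π_μ(f)(b ⊗ a)` after
`μ ↦ -λ - μ`. -/
theorem piMap_eq_zero_of_flip {f : ConformalDual L} {a b : L} (h : piMap L f b a = 0) :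
    piMap L f a b = 0 := by
  refine poly2_funext fun w x => ?_
  have hs := evalFun_evBracket_skew (⊤ : Submodule ℂ[X] (ConformalDual L)) ⟨f, trivial⟩ a b x w
  rw [evalFun_apply, evalFun_apply] at hs
  dsimp only at hs
  rw [eval_piMap, hs, ← eval_piMap, h, map_zero, map_zero, neg_zero]

/-- The substitution `λ ↦ λ - μ`, with values in polynomials in `μ` over `ℂ[λ]`. -/
def shift : Poly2 →ₐ[ℂ] ℂ[X][X] :=
  MvPolynomial.aeval ![Polynomial.C Polynomial.X - Polynomial.X, Polynomial.X]

/-- The outer variable is `μ` and the inner one `λ`. Evaluating them at `x` and `w + x` undoes the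
shift, whence its injectivity. -/
theorem eval_shift (P : Poly2) (w x : ℂ) :
    ((shift P).eval (Polynomial.C x)).eval (w + x) = MvPolynomial.aeval ![w, x] P := by
  induction P using MvPolynomial.induction_on with
  | C c =>
    rw [← MvPolynomial.algebraMap_eq, AlgHom.commutes, AlgHom.commutes]
    simp
  | add P Q hP hQ => simp only [map_add, Polynomial.eval_add, hP, hQ]
  | mul_X P i hP =>
    rw [map_mul, map_mul, Polynomial.eval_mul, Polynomial.eval_mul, hP]
    congr 1
    fin_cases i <;> simp [shift]

theorem shift_injective : Function.Injective shift := by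
  rw [injective_iff_map_eq_zero]
  intro P hP
  refine poly2_funext fun w x => ?_
  rw [← eval_shift, hP]
  simp

/-- The coefficient of `μⁿ` in `b ↦ f_{λ-μ}([a_μ b])`. -/
def muCoeff (f : ConformalDual L) (a : L) (n : ℕ) : ConformalDual L :=
  ⟨((Polynomial.lcoeff ℂ[X] n).restrictScalars ℂ) ∘ₗ shift.toLinearMap ∘ₗ piMap L f a, fun b => by
    change (shift (piMap L f a (der L b))).coeff n
      = Polynomial.X * (shift (piMap L f a b)).coeff n
    rw [piMap_der_right, map_mul]
    -- This is the reason for the shift: `∂b` now multiplies by `λ` alone, without `μ`, so every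
    -- coefficient of `μⁿ` satisfies the condition defining the dual.
    have : shift (lam + mu) = Polynomial.C Polynomial.X := by simp [shift]
    rw [this, Polynomial.coeff_C_mul]⟩

theorem muCoeff_apply (f : ConformalDual L) (a : L) (n : ℕ) (b : L) :
    muCoeff f a n b = (shift (piMap L f a b)).coeff n := rfl

theorem piMap_eq_zero_of_muCoeff {f : ConformalDual L} {a b : L} (h : ∀ n, muCoeff f a n b = 0) :
    piMap L f a b = 0 := by
  apply shift_injective
  rw [map_zero]
  ext1 n
  exact h n

/-! ## Ideals and good submodules -/

theorem IsIdeal.piMap_eq_zero {I : Submodule ℂ[X] L} (hI : IsIdeal I) {f : ConformalDual L}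
    (hf : f ∈ dualAnn I) (a : L) {b : L} (hb : b ∈ I) : piMap L f a b = 0 := by
  obtain ⟨t, ht⟩ := hI a b hb
  rw [piMap_apply, ← ht]
  clear ht
  induction t with
  | zero => simp
  | add s t hs ht => simp only [map_add, hs, ht, add_zero]
  | tmul p v =>
    rw [LinearMap.lTensor_tmul, substAt_tmul, LinearMap.liftBaseChange_tmul,
      ConformalDual.subst_apply]
    have : f (v : L) = 0 := hf v.1 v.2
    change _ • Polynomial.aeval lam (f (v : L)) = 0
    rw [this, map_zero, smul_zero]

theorem IsIdeal.muCoeff_mem {I : Submodule ℂ[X] L} (hI : IsIdeal I) {f : ConformalDual L}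
    (hf : f ∈ dualAnn I) (a : L) (n : ℕ) : muCoeff f a n ∈ dualAnn I := by
  intro b hb
  rw [muCoeff_apply, hI.piMap_eq_zero hf a hb, map_zero, Polynomial.coeff_zero]

/-- Extends the vanishing from `I` to the possibly larger `commonKer (dualAnn I)`: the coefficients
in `μ` of `π_μ(f)(a ⊗ ·)` are themselves functionals in `dualAnn I`. -/
theorem IsIdeal.piMap_eq_zero_right {I : Submodule ℂ[X] L} (hI : IsIdeal I) {f : ConformalDual L}
    (hf : f ∈ dualAnn I) (a : L) {b : L} (hb : b ∈ commonKer (dualAnn I)) :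
    piMap L f a b = 0 :=
  piMap_eq_zero_of_muCoeff fun n => hb _ (hI.muCoeff_mem hf a n)

/-- The annihilator of an ideal of cofinite rank is good. -/
theorem IsIdeal.isGood_dualAnn {I : Submodule ℂ[X] L} (hI : IsIdeal I)
    (hr : HasFiniteRank (L ⧸ I)) : IsGood (dualAnn I) := by
  intro f hf
  set K := commonKer (dualAnn I) with hK
  have hIK : I ≤ K := fun a ha f hf => hf a ha
  -- `L ⧸ I` may have torsion or fail to be finitely generated. Enlarging `I` to `K` gives a finite
  -- free quotient.
  have := finite_quotient_commonKer (hasFiniteRank_dualAnn hr)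
  have := free_quotient_commonKer (hasFiniteRank_dualAnn hr)
  let β := Module.Free.chooseBasis ℂ[X] (L ⧸ K)
  let α : Module.Free.ChooseBasisIndex ℂ[X] (L ⧸ K) → L := fun i => (β i).out
  have hα : ∀ i, Submodule.Quotient.mk (α i) = β i := fun i => Quotient.out_eq _
  let g : Module.Free.ChooseBasisIndex ℂ[X] (L ⧸ K) → ConformalDual L :=
    fun i => ConformalDual.ofPolyLin (β.coord i ∘ₗ K.mkQ)
  have hg : ∀ i, g i ∈ dualAnn I := by
    intro i a ha
    have : K.mkQ a = 0 := (Submodule.Quotient.mk_eq_zero K).mpr (hIK ha)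
    rw [ConformalDual.ofPolyLin_apply, LinearMap.comp_apply, this, map_zero]
  have hdecomp : ∀ a, a - ∑ i, g i a • α i ∈ K := by
    intro a
    rw [← Submodule.Quotient.mk_eq_zero, Submodule.Quotient.mk_sub, sub_eq_zero,
      ← Submodule.mkQ_apply, ← Submodule.mkQ_apply, map_sum]
    simp only [map_smul, Submodule.mkQ_apply, hα]
    exact (β.sum_repr _).symm
  have hright : ∀ a b, piMap L f a b
      = ∑ j, Polynomial.aeval (lam + mu) (g j b) * piMap L f a (α j) := by
    intro a b
    have := hI.piMap_eq_zero_right hf a (hdecomp b)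
    rw [map_sub, sub_eq_zero, map_sum] at this
    simpa only [piMap_poly_smul_right] using this
  have hleft : ∀ a b, piMap L f a b
      = ∑ i, Polynomial.aeval (-mu) (g i a) * piMap L f (α i) b := by
    intro a b
    have := piMap_eq_zero_of_flip (hI.piMap_eq_zero_right hf b (hdecomp a))
    rw [map_sub, LinearMap.sub_apply, sub_eq_zero, map_sum, LinearMap.sum_apply] at this
    simpa only [piMap_poly_smul_left] using this
  -- The values `π_μ(f)(α i ⊗ α j)` are the polynomial coefficients to be absorbed into `dualAnn I ⊗
  -- dualAnn I`.
  choose t ht ht' using fun i j =>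
    exists_Phi_eq_mul (dualAnn I) (hg i) (hg j) (piMap L f (α i) (α j))
  refine ⟨∑ i, ∑ j, t i j, sum_mem fun i _ => sum_mem fun j _ => ht i j, ?_⟩
  ext1 a
  ext1 b
  rw [hleft]
  simp only [map_sum, LinearMap.sum_apply, ht']
  refine Finset.sum_congr rfl fun i _ => ?_
  rw [hright, Finset.mul_sum]
  refine Finset.sum_congr rfl fun j _ => ?_
  ring

theorem IsGood.piMap_eq_zero {V : Submodule ℂ[X] (ConformalDual L)} (hV : IsGood V)
    {f : ConformalDual L} (hf : f ∈ V) (a : L) {b : L} (hb : b ∈ commonKer V) :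
    piMap L f a b = 0 := by
  obtain ⟨_, ⟨t, rfl⟩, ht⟩ := hV f hf
  rw [← ht]
  clear ht
  induction t with
  | zero => simp
  | add s t hs ht => simp only [map_add, LinearMap.add_apply, hs, ht, add_zero]
  | tmul g h =>
    rw [TensorProduct.map_tmul, Phi_tmul, ConformalDual.subst_apply _ _ b]
    have : (h : ConformalDual L) b = 0 := hb h.1 h.2
    change _ * Polynomial.aeval _ ((h : ConformalDual L) b) = 0
    rw [this, map_zero, mul_zero]

/-- The common kernel of a good submodule is an ideal. -/
theorem IsGood.isIdeal_commonKer {V : Submodule ℂ[X] (ConformalDual L)} (hV : IsGood V) :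
    IsIdeal (commonKer V) := by
  intro a b hb
  let ι : commonKer V →ₗ[ℂ] L := (commonKer V).subtype.restrictScalars ℂ
  let q : L →ₗ[ℂ] L ⧸ commonKer V := (commonKer V).mkQ.restrictScalars ℂ
  have hex : Function.Exact ι q := by
    intro c
    change (commonKer V).mkQ c = 0 ↔ c ∈ Set.range (commonKer V).subtype
    simp
  have hq : Function.Surjective q := (commonKer V).mkQ_surjective
  -- By right exactness it suffices that `[a_λ b]` dies in `ℂ[λ] ⊗ (L ⧸ commonKer V)`.
  refine (lTensor_exact ℂ[X] hex hq _).mp ?_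
  -- The values `f_w` with `f ∈ V` and `w ∈ ℂ` separate the points of the quotient, by the
  -- definition of `commonKer V`. Together with the evaluations of `ℂ[λ]` they detect zero in the
  -- tensor product.
  let ψ : V × ℂ → (L ⧸ commonKer V) →ₗ[ℂ] ℂ := fun j =>
    (Polynomial.aeval j.2).toLinearMap ∘ₗ
      ((commonKer V).liftQ j.1.1.toPolyLin fun c hc => hc j.1.1 j.1.2).restrictScalars ℂ
  have hψ : ∀ (f : V) (w : ℂ) (c : L), ψ (f, w) (q c) = (f.1 c).eval w := by
    intro f w c
    change Polynomial.aeval w (f.1 c) = _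
    rw [Polynomial.coe_aeval_eq_eval]
  refine tensorFun_separates (fun x : ℂ => (Polynomial.aeval x).toLinearMap) ψ
    (fun p hp => Polynomial.funext fun x => ?_) (fun y hy => ?_) _ fun x j => ?_
  · have := hp x
    rw [AlgHom.toLinearMap_apply, Polynomial.coe_aeval_eq_eval] at this
    rw [this, Polynomial.eval_zero]
  · obtain ⟨c, rfl⟩ := hq y
    refine (hex c).mpr ⟨⟨c, fun f hf => Polynomial.funext fun w => ?_⟩, rfl⟩
    rw [← hψ ⟨f, hf⟩, hy, Polynomial.eval_zero]
  · obtain ⟨f, w⟩ := j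
    -- The functional to be killed is the value of `π_μ(f)(a ⊗ b)` at `λ = w`, `μ = x`.
    have h0 := eval_piMap f.1 a b w x
    rw [hV.piMap_eq_zero f.2 a hb, map_zero] at h0
    rw [h0, evBracket]
    generalize LieConformalAlgebra.bracket a b = t
    induction t with
    | zero => simp
    | add s t hs ht => simp only [map_add, hs, ht, Polynomial.eval_add]
    | tmul p v =>
      rw [LinearMap.lTensor_tmul, tensorFun_tmul, hψ, substAt_tmul, TensorProduct.lid_tmul,
        map_smul, Polynomial.eval_smul, smul_eq_mul]
      rfl

theorem mem_sSup_good_iff_exists_ideal {f : ConformalDual L} :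
    f ∈ sSup {V : Submodule ℂ[X] (ConformalDual L) | IsGood V ∧ HasFiniteRank V} ↔
      ∃ I : Submodule ℂ[X] L, IsIdeal I ∧ HasFiniteRank (L ⧸ I) ∧ ∀ a ∈ I, f a = 0 := by
  rw [mem_sSup_good_iff]
  constructor
  · rintro ⟨V, hV, hr, hf⟩
    have := finite_quotient_commonKer hr
    exact ⟨commonKer V, hV.isIdeal_commonKer, hasFiniteRank_of_finite _, fun a ha => ha f hf⟩
  · rintro ⟨I, hI, hr, hf⟩
    exact ⟨dualAnn I, hI.isGood_dualAnn hr, hasFiniteRank_dualAnn hr, hf⟩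

end PiMap

end LieConf

end

/-- The locally finite part of the upper zero of a Lie conformal algebra that is free as a
`ℂ[∂]`-module. -/
theorem theorem4p3 {L : Type*} [AddCommGroup L] [Module ℂ L] [Module ℂ[X] L]
    [IsScalarTower ℂ ℂ[X] L] [LieConf.LieConformalAlgebra L] [Module.Free ℂ[X] L] :
    ((LieConf.Loc (LieConf.upperZero L)).map (LieConf.upperZero L).subtype :
        Set (LieConf.ConformalDual L))
      = {f | ∃ I : Submodule ℂ[X] L, LieConf.IsIdeal I ∧ LieConf.HasFiniteRank (L ⧸ I) ∧
          ∀ a ∈ I, f a = 0} ∧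
    (LieConf.Loc (LieConf.upperZero L)).map (LieConf.upperZero L).subtype
      = sSup {V : Submodule ℂ[X] (LieConf.ConformalDual L) |
          LieConf.IsGood V ∧ LieConf.HasFiniteRank V} ∧
    IsGreatest {N : Submodule ℂ[X] (LieConf.upperZero L) |
        LieConf.IsSubcoalgebra N ∧ LieConf.IsLocallyFinite N}
      (LieConf.Loc (LieConf.upperZero L)) := by
  refine ⟨?_, LieConf.map_loc_eq_sSup L, LieConf.isGreatest_loc L⟩
  rw [LieConf.map_loc_eq_sSup]
  exact Set.ext fun f => LieConf.mem_sSup_good_iff_exists_ideal
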